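/- Let $P$ be a finite distributive lattice and let $Z_2(P)=\{(\alpha,\beta)\in P\times P:\alpha\le\beta\}$ be its second zig-zag poset, ordered by $(\alpha,\beta)\le(\gamma,\delta)$ if and only if $\alpha\le\gamma$ and $\beta\ge\delta$. Let $K$ be a field. An algebra with straightening laws (ASL) over $K$ on a finite poset $Q$ is a commutative $K$-algebra $A$ with $Q\subset A$ such that: (0) $A=\bigoplus_{i\ge 0}A_i$ is graded with $A_0=K$, and the elements of $Q$ are homogeneous of positive degree and generate $A$ as a $K$-algebra; (1) the standard monomials $\gamma_1\gamma_2\cdots\gamma_t$, one for each multichain $\gamma_1\le\gamma_2\le\dots\le\gamma_t$ in $Q$ with $t\ge 0$, form a $K$-basis of $A$; (2) if $\alpha,\beta\in Q$ are incomparable, then every standard monomial $\gamma_1\cdots\gamma_t$ with $\gamma_1\le\dots\le\gamma_t$ that occurs with nonzero coefficient in the expansion of $\alpha\beta$ in this basis satisfies $t\ge 1$, $\gamma_1<\alpha$ and $\gamma_1<\beta$. The poset $Q$ is called integral over $K$ if there is an ASL over $K$ on $Q$ that is an integral domain. Let $A=K[x_\alpha:\alpha\in P]/(x_\alpha x_\beta-x_{\alpha\wedge\beta}x_{\alpha\vee\beta}:\alpha,\beta\in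 P\text{ incomparable})$ be the Hibi ring of $P$, graded by $\deg x_\alpha=1$, and let $A^{(2)}=\bigoplus_{i\ge0}A_{2i}$ be its second Veronese algebra, with $A_{2i}$ in degree $i$. Then, for every field $K$, the poset $Z_2(P)$ is integral over $K$. More precisely, $A^{(2)}$ is an integral domain, and it is an ASL over $K$ on $Z_2(P)$, where $(\alpha,\beta)\in Z_2(P)$ is identified with $x_\alpha x_\beta\in A^{(2)}$. -/

import Mathlib

/-- The `d`-th zig-zag poset of a poset `P`: its elements are the multichains
`a 0 ≤ a 1 ≤ ⋯ ≤ a (d - 1)` of length `d` in `P`. -/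
structure ZigZag (d : ℕ) (P : Type*) [PartialOrder P] where
  toFun : Fin d → P
  monotone' : Monotone toFun

/-- The zig-zag order: `a ≤ b` iff `a 0 ≤ b 0`, `a 1 ≥ b 1`, `a 2 ≤ b 2`, `a 3 ≥ b 3`, etc. -/
instance ZigZag.instPartialOrder (d : ℕ) (P : Type*) [PartialOrder P] :
    PartialOrder (ZigZag d P) where
  le a b := ∀ i : Fin d,
    (Even (i : ℕ) → a.toFun i ≤ b.toFun i) ∧ (Odd (i : ℕ) → b.toFun i ≤ a.toFun i)
  le_refl a i := ⟨fun _ => le_rfl, fun _ => le_rfl⟩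
  le_trans a b c hab hbc i :=
    ⟨fun h => ((hab i).1 h).trans ((hbc i).1 h), fun h => ((hbc i).2 h).trans ((hab i).2 h)⟩
  le_antisymm a b hab hba := by
    cases a with
    | mk f hf =>
      cases b with
      | mk g hg =>
        have : f = g := by
          funext i
          rcases Nat.even_or_odd (i : ℕ) with h | h
          · exact le_antisymm ((hab i).1 h) ((hba i).1 h)
          · exact le_antisymm ((hba i).2 h) ((hab i).2 h)
        subst this
        rfl

instance ZigZag.instFinite (d : ℕ) (P : Type*) [PartialOrder P] [Finite P] :
    Finite (ZigZag d P) :=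
  Finite.of_injective (fun z : ZigZag d P => z.toFun) (by
    rintro ⟨f, hf⟩ ⟨g, hg⟩ h
    cases h
    rfl)

/-- The multichains `γ₁ ≤ γ₂ ≤ ⋯ ≤ γₜ` (`t ≥ 0`) of a poset `Q`; they index the standard
monomials. -/
abbrev Multichain (Q : Type*) [PartialOrder Q] : Type _ :=
  {l : List Q // l.Pairwise (· ≤ ·)}

/-- The standard monomial `γ₁ γ₂ ⋯ γₜ` in `A` given by a multichain `γ₁ ≤ γ₂ ≤ ⋯ ≤ γₜ` of `Q`,
where `Q` is placed in `A` by `ι`. The empty multichain gives `1`. -/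
def standardMonomial {Q A : Type*} [PartialOrder Q] [CommRing A] (ι : Q → A)
    (l : Multichain Q) : A :=
  (l.1.map ι).prod

/-- The `K`-algebra `A`, with homogeneous components `𝒜 i`, is a (graded) algebra with
straightening laws over `K` on the finite poset `Q`, regarded as a subset of `A` through `ι`. -/
structure IsASL (K : Type*) {A Q : Type*} [Field K] [CommRing A] [Algebra K A]
    [PartialOrder Q] [Finite Q] (𝒜 : ℕ → Submodule K A) (ι : Q → A) : Prop where
  /-- `Q` is a subset of `A`. -/
  injective : Function.Injective ι
  /-- `1 ∈ 𝒜 0` and `𝒜 i * 𝒜 j ⊆ 𝒜 (i + j)`. -/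
  gradedMonoid : SetLike.GradedMonoid 𝒜
  /-- `A` is the direct sum of the `𝒜 i`. -/
  isInternal : DirectSum.IsInternal 𝒜
  /-- The degree zero component is `K`, that is, the image of `K` in `A`. -/
  degree_zero : 𝒜 0 = LinearMap.range (Algebra.linearMap K A)
  /-- The elements of `Q` are homogeneous of positive degree. -/
  homogeneous : ∀ q : Q, ∃ n : ℕ, 0 < n ∧ ι q ∈ 𝒜 n
  /-- The elements of `Q` generate `A` as a `K`-algebra. -/
  generate : Algebra.adjoin K (Set.range ι) = ⊤
  /-- The standard monomials are linearly independent over `K`. -/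
  linearIndependent : LinearIndependent K (standardMonomial (Q := Q) ι)
  /-- The standard monomials span `A` over `K`. -/
  span_eq_top : Submodule.span K (Set.range (standardMonomial (Q := Q) ι)) = ⊤
  /-- Straightening laws: for incomparable `α`, `β`, every standard monomial occurring with non-zero
  coefficient in the expansion of `α β` has a first (smallest) factor `γ` (in particular it is not
  the empty monomial), and `γ < α`, `γ < β`. The expansion `c` is unique, since the standard
  monomials are a basis. -/
  straightening : ∀ α β : Q, ¬ α ≤ β → ¬ β ≤ α →
    ∃ c : Multichain Q →₀ K,
      ι α * ι β = Finsupp.linearCombination K (standardMonomial (Q := Q) ι) c ∧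
      ∀ l ∈ c.support, ∃ γ : Q, l.1.head? = some γ ∧ γ < α ∧ γ < β

/-- A finite poset `Q` is integral over the field `K` if there is an algebra with straightening laws
on `Q` over `K` that is an integral domain. -/
def IsIntegralPoset.{u, v} (K : Type u) (Q : Type v) [Field K] [PartialOrder Q] [Finite Q] :
    Prop :=
  ∃ (A : Type (max u v)) (_ : CommRing A) (_ : Algebra K A) (𝒜 : ℕ → Submodule K A) (ι : Q → A),
    IsASL K 𝒜 ι ∧ IsDomain A

section Veronese

variable {K A : Type*} [Field K] [CommRing A] [Algebra K A]

/-- The `d`-th Veronese algebra `⨁ i, 𝒜 (d * i)` of `A = ⨁ i, 𝒜 i`, as a subalgebra of `A`. -/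
noncomputable def veronese (𝒜 : ℕ → Submodule K A) [SetLike.GradedMonoid 𝒜] (d : ℕ) : Subalgebra K A :=
  Submodule.toSubalgebra (⨆ i : ℕ, 𝒜 (d * i))
    (Submodule.mem_iSup_of_mem 0 (by simpa using SetLike.GradedOne.one_mem (A := 𝒜)))
    (by
      intro x y hx hy
      have h : (⨆ i : ℕ, 𝒜 (d * i)) * (⨆ i : ℕ, 𝒜 (d * i)) ≤ ⨆ i : ℕ, 𝒜 (d * i) := by
        rw [Submodule.iSup_mul]
        refine iSup_le fun i => ?_
        rw [Submodule.mul_iSup]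
        refine iSup_le fun j => Submodule.mul_le.2 fun a ha b hb => ?_
        refine Submodule.mem_iSup_of_mem (i + j) ?_
        rw [mul_add]
        exact SetLike.GradedMul.mul_mem ha hb
      exact h (Submodule.mul_mem_mul hx hy))

/-- The grading of the `d`-th Veronese algebra: its component of degree `i` is `𝒜 (d * i)`. -/
noncomputable def veroneseGrading (𝒜 : ℕ → Submodule K A) [SetLike.GradedMonoid 𝒜] (d i : ℕ) :
    Submodule K (veronese 𝒜 d) :=
  (𝒜 (d * i)).comap (veronese 𝒜 d).val.toLinearMap

end Veronese

section Hibi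

variable (K P : Type*) [Field K] [DistribLattice P]

/-- The ideal of the polynomial ring `K[P]` generated by the Hibi relations
`x_α x_β - x_(α ⊓ β) x_(α ⊔ β)`, for `α`, `β` incomparable. -/
noncomputable def hibiIdeal : Ideal (MvPolynomial P K) :=
  Ideal.span {f | ∃ α β : P, ¬ α ≤ β ∧ ¬ β ≤ α ∧
    f = MvPolynomial.X α * MvPolynomial.X β - MvPolynomial.X (α ⊓ β) * MvPolynomial.X (α ⊔ β)}

/-- The Hibi ring of the distributive lattice `P` over `K`. -/
noncomputable abbrev HibiRing : Type _ := MvPolynomial P K ⧸ hibiIdeal K P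

/-- The grading of the Hibi ring by total degree: the degree `i` component consists of the classes
of homogeneous polynomials of degree `i`. -/
noncomputable def hibiGrading (i : ℕ) : Submodule K (HibiRing K P) :=
  (MvPolynomial.homogeneousSubmodule P K i).map (Ideal.Quotient.mkₐ K (hibiIdeal K P)).toLinearMap

instance hibiGrading.instGradedMonoid : SetLike.GradedMonoid (hibiGrading K P) where
  one_mem := ⟨1, MvPolynomial.isHomogeneous_one P K, map_one (Ideal.Quotient.mkₐ K _)⟩
  mul_mem := by
    rintro i j _ _ ⟨f, hf, rfl⟩ ⟨g, hg, rfl⟩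
    exact ⟨f * g, MvPolynomial.IsHomogeneous.mul hf hg, map_mul (Ideal.Quotient.mkₐ K _) f g⟩

variable {P}

/-- The generator of the Hibi ring given by an element of `P`. -/
noncomputable def hibiVar (α : P) : HibiRing K P :=
  Ideal.Quotient.mkₐ K (hibiIdeal K P) (MvPolynomial.X α)

/-- The element of the `d`-th Veronese algebra of the Hibi ring given by a multichain
`α 0 ≤ ⋯ ≤ α (d - 1)` of `P`: the standard monomial `x_(α 0) ⋯ x_(α (d - 1))`. -/
noncomputable def zigZagMonomial (d : ℕ) (z : ZigZag d P) : veronese (hibiGrading K P) d :=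
  ⟨∏ i, hibiVar K (z.toFun i), by
    refine Submodule.mem_iSup_of_mem (p := fun i => hibiGrading K P (d * i)) 1 ?_
    refine ⟨∏ i, MvPolynomial.X (z.toFun i), ?_, ?_⟩
    · have := MvPolynomial.IsHomogeneous.prod (R := K) Finset.univ
        (fun i => MvPolynomial.X (z.toFun i)) (fun _ => 1)
        (fun i _ => MvPolynomial.isHomogeneous_X K (z.toFun i))
      simpa using this
    · exact map_prod (Ideal.Quotient.mkₐ K (hibiIdeal K P)) _ _⟩

end Hibi

/-! Write pairs of the zig-zag poset as `(a₀, a₁)`. Three Hibi relations turn the product of `z =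
(a₀, a₁)` and `w = (b₀, b₁)` into one product of comparable pairs. The lower factor is the meet `(a₀
⊓ b₀, a₁ ⊔ b₁)` of `z` and `w`; the upper factor is made from the two middle elements `a₀ ⊔ b₀` and
`a₁ ⊓ b₁`. This is the straightening law, and repeating it shows that standard monomials span.

For independence, send `x_a` to the product of variables `t_S` over the prime sets `S` containing
`a`. A standard monomial of length `t` becomes a monomial whose exponent at `S` is `2t` exactly when
`S` contains the bottom of the first pair, and `0` exactly when `S` misses its top. Prime sets
separate points, so the exponents determine the first pair and, by induction, the whole multichain
(`ZigZag.eq_of_sum_exponent_eq`). Distinct standard monomials thus have distinct monomial images, so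
the map is injective on the Veronese algebra, which is therefore a domain. -/

section Straightening

/-! ### Straightening by insertion -/

variable {Q A : Type*} [CommRing A]

/-- Inserts an element into a multichain by repeatedly straightening products of two elements `a`,
`b` into `m a b`, `j a b`. -/
def straightenInsert (m j : Q → Q → Q) : Q → List Q → List Q
  | a, [] => [a]
  | a, b :: l => m a b :: straightenInsert m j (j a b) l

variable {m j : Q → Q → Q}

theorem prod_map_straightenInsert (ι : Q → A) (h : ∀ a b, ι a * ι b = ι (m a b) * ι (j a b))
    (a : Q) (l : List Q) :
    ((straightenInsert m j a l).map ι).prod = ι a * (l.map ι).prod := by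
  induction l generalizing a with
  | nil => simp [straightenInsert]
  | cons b l ih =>
    rw [straightenInsert, List.map_cons, List.prod_cons, ih, ← mul_assoc, ← h, List.map_cons,
      List.prod_cons, mul_assoc]

variable [PartialOrder Q]

/-- A common lower bound survives each exchange: it lies below `m a b`, hence below the carried
element `j a b`. -/
theorem le_of_mem_straightenInsert (hinf : ∀ z a b, z ≤ a → z ≤ b → z ≤ m a b)
    (hmj : ∀ a b, m a b ≤ j a b) {z a : Q} {l : List Q} (ha : z ≤ a) (hl : ∀ b ∈ l, z ≤ b) :
    ∀ c ∈ straightenInsert m j a l, z ≤ c := by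
  induction l generalizing a with
  | nil => simpa [straightenInsert] using ha
  | cons b l ih =>
    have hz := hinf z a b ha (hl b List.mem_cons_self)
    intro c hc
    rcases List.mem_cons.1 hc with rfl | hc
    · exact hz
    · exact ih (hz.trans (hmj a b)) (fun b hb => hl b (List.mem_cons_of_mem _ hb)) c hc

theorem pairwise_straightenInsert (hinf : ∀ z a b, z ≤ a → z ≤ b → z ≤ m a b)
    (hmj : ∀ a b, m a b ≤ j a b) (hm : ∀ a b, m a b ≤ b) {a : Q} {l : List Q}
    (hl : l.Pairwise (· ≤ ·)) : (straightenInsert m j a l).Pairwise (· ≤ ·) := by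
  induction l generalizing a with
  | nil => simp [straightenInsert]
  | cons b l ih =>
    rw [List.pairwise_cons] at hl
    exact List.pairwise_cons.2 ⟨le_of_mem_straightenInsert hinf hmj (hmj a b)
      fun c hc => (hm a b).trans (hl.1 c hc), ih hl.2⟩

/-- If products of two elements can be straightened, then every product is a standard monomial. -/
theorem exists_standardMonomial_eq_prod (ι : Q → A)
    (h : ∀ a b, ι a * ι b = ι (m a b) * ι (j a b))
    (hinf : ∀ z a b, z ≤ a → z ≤ b → z ≤ m a b) (hmj : ∀ a b, m a b ≤ j a b)
    (hm : ∀ a b, m a b ≤ b) (l : List Q) :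
    ∃ c : Multichain Q, standardMonomial ι c = (l.map ι).prod := by
  induction l with
  | nil => exact ⟨⟨[], List.Pairwise.nil⟩, rfl⟩
  | cons a l ih =>
    obtain ⟨c, hc⟩ := ih
    refine ⟨⟨_, pairwise_straightenInsert (a := a) hinf hmj hm c.2⟩, ?_⟩
    rw [List.map_cons, List.prod_cons, ← hc]
    exact prod_map_straightenInsert ι h a c.1

end Straightening

theorem LinearMap.injective_of_linearIndependent_comp {K V W κ : Type*} [Field K]
    [AddCommGroup V] [Module K V] [AddCommGroup W] [Module K W] {v : κ → V} (f : V →ₗ[K] W)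
    (hspan : Submodule.span K (Set.range v) = ⊤) (hli : LinearIndependent K (f ∘ v)) :
    Function.Injective f := by
  rw [injective_iff_map_eq_zero]
  intro x hx
  have hmem : x ∈ Submodule.span K (Set.range v) := hspan ▸ Submodule.mem_top
  obtain ⟨c, rfl⟩ := (Finsupp.mem_span_range_iff_exists_finsupp).1 hmem
  have h0 : Finsupp.linearCombination K (f ∘ v) c = 0 := by
    rw [← hx, Finsupp.linearCombination_apply, map_finsuppSum]
    simp
  rw [linearIndependent_iff.1 hli c h0]
  simp

/-! ### Order structure of the second zig-zag poset -/

namespace ZigZag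

variable {P : Type*}

/-- The element `(a, b)` of the second zig-zag poset. -/
def pair [PartialOrder P] (a b : P) (h : a ≤ b) : ZigZag 2 P :=
  ⟨![a, b], by
    rw [Fin.monotone_iff_le_succ]
    intro i
    fin_cases i
    exact h⟩

section PartialOrder

variable [PartialOrder P]

theorem zero_le_one (z : ZigZag 2 P) : z.toFun 0 ≤ z.toFun 1 :=
  z.monotone' (Fin.zero_le 1)

theorem le_iff {z w : ZigZag 2 P} :
    z ≤ w ↔ z.toFun 0 ≤ w.toFun 0 ∧ w.toFun 1 ≤ z.toFun 1 := by
  change (∀ i : Fin 2, _) ↔ _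
  simp [Fin.forall_fin_two]

@[simp] theorem pair_zero (a b : P) (h : a ≤ b) : (pair a b h).toFun 0 = a := rfl

@[simp] theorem pair_one (a b : P) (h : a ≤ b) : (pair a b h).toFun 1 = b := rfl

end PartialOrder

variable [DistribLattice P]

/-- The smaller factor of the straightened product of `z` and `w`. -/
def lower (z w : ZigZag 2 P) : ZigZag 2 P :=
  pair (z.toFun 0 ⊓ w.toFun 0) (z.toFun 1 ⊔ w.toFun 1)
    (inf_le_left.trans (z.zero_le_one.trans le_sup_left))

/-- The larger factor of the straightened product of `z` and `w`. -/
def upper (z w : ZigZag 2 P) : ZigZag 2 P :=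
  pair ((z.toFun 0 ⊔ w.toFun 0) ⊓ (z.toFun 1 ⊓ w.toFun 1))
    ((z.toFun 0 ⊔ w.toFun 0) ⊔ (z.toFun 1 ⊓ w.toFun 1)) inf_le_sup

/-- With the next two lemmas, this makes `lower z w` the meet of `z` and `w`, as insertion requires.
-/
theorem le_lower (y z w : ZigZag 2 P) (hz : y ≤ z) (hw : y ≤ w) : y ≤ lower z w := by
  rw [le_iff] at *
  exact ⟨le_inf hz.1 hw.1, sup_le hz.2 hw.2⟩

theorem lower_le_left (z w : ZigZag 2 P) : lower z w ≤ z :=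
  le_iff.2 ⟨inf_le_left, le_sup_left⟩

theorem lower_le_right (z w : ZigZag 2 P) : lower z w ≤ w :=
  le_iff.2 ⟨inf_le_right, le_sup_right⟩

theorem lower_le_upper (z w : ZigZag 2 P) : lower z w ≤ upper z w :=
  le_iff.2 ⟨le_inf (inf_le_left.trans le_sup_left)
    (le_inf (inf_le_left.trans z.zero_le_one) (inf_le_right.trans w.zero_le_one)),
    sup_le (sup_le_sup z.zero_le_one w.zero_le_one) (inf_le_left.trans le_sup_left)⟩

end ZigZag

/-! ### Prime sets and exponent vectors -/

section PrimeSets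

variable (P : Type*) [DistribLattice P]

/-- The subsets of a lattice whose membership predicate is a lattice homomorphism: the prime
filters, the empty set and the whole lattice. -/
abbrev PrimeSet : Type _ :=
  {S : Set P // ∀ a b, (a ⊓ b ∈ S ↔ a ∈ S ∧ b ∈ S) ∧ (a ⊔ b ∈ S ↔ a ∈ S ∨ b ∈ S)}

/-- The whole lattice as a prime set. -/
def PrimeSet.univ : PrimeSet P := ⟨Set.univ, by simp⟩

variable {P}

theorem PrimeSet.mem_of_le (S : PrimeSet P) {a b : P} (h : a ≤ b) (ha : a ∈ S.1) : b ∈ S.1 := by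
  have := (S.2 a b).1
  rw [inf_eq_left.2 h] at this
  exact (this.1 ha).2

theorem PrimeSet.exists_mem_notMem {a b : P} (h : ¬ a ≤ b) :
    ∃ S : PrimeSet P, a ∈ S.1 ∧ b ∉ S.1 := by
  obtain ⟨I, hI, hb, ha⟩ := DistribLattice.prime_ideal_of_disjoint_filter_ideal
    (F := Order.PFilter.principal a) (I := Order.Ideal.principal b) (by
      rw [Set.disjoint_left]
      intro x hx hx'
      exact h ((Order.PFilter.mem_principal.1 hx).trans (Order.Ideal.mem_principal.1 hx')))
  -- The prime ideal `I` contains `b` and avoids `a`; its complement is the separating prime set.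
  refine ⟨⟨(I : Set P)ᶜ, fun x y => ⟨?_, ?_⟩⟩, ?_, ?_⟩
  · rw [Set.mem_compl_iff, Set.mem_compl_iff, Set.mem_compl_iff, ← not_or]
    refine not_congr ⟨fun hxy => hI.mem_or_mem hxy, ?_⟩
    rintro (hx | hy)
    · exact I.lower inf_le_left hx
    · exact I.lower inf_le_right hy
  · rw [Set.mem_compl_iff, Set.mem_compl_iff, Set.mem_compl_iff, ← not_and_or]
    exact not_congr (Order.Ideal.sup_mem_iff)
  · exact fun hx => Set.disjoint_left.1 ha (Order.PFilter.mem_principal.2 le_rfl) hx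
  · exact fun hx => hx (hb (Order.Ideal.mem_principal.2 le_rfl))

theorem PrimeSet.le_of_forall {a b : P} (h : ∀ S : PrimeSet P, a ∈ S.1 → b ∈ S.1) : a ≤ b := by
  by_contra hab
  obtain ⟨S, ha, hb⟩ := PrimeSet.exists_mem_notMem hab
  exact hb (h S ha)

variable [Finite P]

open Classical in
/-- The exponent vector recording which prime sets contain `a`. -/
noncomputable def primeExponent (a : P) : PrimeSet P →₀ ℕ :=
  Finsupp.equivFunOnFinite.symm fun S => if a ∈ S.1 then 1 else 0

open Classical in
theorem primeExponent_apply (a : P) (S : PrimeSet P) :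
    primeExponent a S = if a ∈ S.1 then 1 else 0 := rfl

/-- At each coordinate, membership is a lattice homomorphism to `{0, 1}`, where the sum of two
values equals min plus max. Hence the Hibi relations hold for the image monomials. -/
theorem primeExponent_add (a b : P) :
    primeExponent a + primeExponent b = primeExponent (a ⊓ b) + primeExponent (a ⊔ b) := by
  ext S
  have hinf : a ⊓ b ∈ S.1 ↔ a ∈ S.1 ∧ b ∈ S.1 := (S.2 a b).1
  have hsup : a ⊔ b ∈ S.1 ↔ a ∈ S.1 ∨ b ∈ S.1 := (S.2 a b).2
  simp only [Finsupp.add_apply, primeExponent_apply]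
  by_cases ha : a ∈ S.1 <;> by_cases hb : b ∈ S.1 <;> simp [hinf, hsup, ha, hb]

/-- This coordinate counts the factors `x_a`, so the degree can be read off from the image. -/
theorem primeExponent_univ (a : P) : primeExponent a (PrimeSet.univ P) = 1 := by
  simp [primeExponent_apply, PrimeSet.univ]

/-- The exponent vector of an element of the second zig-zag poset. -/
noncomputable def ZigZag.exponent (z : ZigZag 2 P) : PrimeSet P →₀ ℕ :=
  primeExponent (z.toFun 0) + primeExponent (z.toFun 1)

theorem ZigZag.exponent_le_two (z : ZigZag 2 P) (S : PrimeSet P) : z.exponent S ≤ 2 := by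
  simp only [ZigZag.exponent, Finsupp.add_apply, primeExponent_apply]
  split_ifs <;> omega

theorem ZigZag.exponent_univ (z : ZigZag 2 P) : z.exponent (PrimeSet.univ P) = 2 := by
  simp [ZigZag.exponent, primeExponent_univ]

theorem ZigZag.exponent_eq_two_iff (z : ZigZag 2 P) (S : PrimeSet P) :
    z.exponent S = 2 ↔ z.toFun 0 ∈ S.1 := by
  have := S.mem_of_le z.zero_le_one
  simp only [ZigZag.exponent, Finsupp.add_apply, primeExponent_apply]
  split_ifs <;> simp_all

theorem ZigZag.exponent_eq_zero_iff (z : ZigZag 2 P) (S : PrimeSet P) :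
    z.exponent S = 0 ↔ z.toFun 1 ∉ S.1 := by
  have := S.mem_of_le z.zero_le_one
  simp only [ZigZag.exponent, Finsupp.add_apply, primeExponent_apply]
  split_ifs <;> simp_all

theorem ZigZag.sum_exponent_apply (l : List (ZigZag 2 P)) (S : PrimeSet P) :
    (l.map ZigZag.exponent).sum S = (l.map fun z => z.exponent S).sum := by
  induction l with
  | nil => rfl
  | cons a l ih => simp [ih]

theorem ZigZag.sum_exponent_univ (l : List (ZigZag 2 P)) :
    (l.map ZigZag.exponent).sum (PrimeSet.univ P) = 2 * l.length := by
  simp [ZigZag.sum_exponent_apply, ZigZag.exponent_univ, mul_comm]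

theorem ZigZag.sum_exponent_le (l : List (ZigZag 2 P)) (S : PrimeSet P) :
    (l.map ZigZag.exponent).sum S ≤ 2 * l.length := by
  induction l with
  | nil => simp
  | cons a l ih =>
    have := a.exponent_le_two S
    simp only [List.map_cons, List.sum_cons, Finsupp.add_apply, List.length_cons]
    omega

/-- The first pair has the smallest bottom element; if `S` contains it, every pair of the multichain
contributes the maximal value 2. -/
theorem ZigZag.sum_exponent_eq_iff {a : ZigZag 2 P} {l : List (ZigZag 2 P)}
    (h : (a :: l).Pairwise (· ≤ ·)) (S : PrimeSet P) :
    ((a :: l).map ZigZag.exponent).sum S = 2 * (a :: l).length ↔ a.toFun 0 ∈ S.1 := by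
  rw [← a.exponent_eq_two_iff S]
  have h1 := ZigZag.sum_exponent_le l S
  have h2 := a.exponent_le_two S
  have h3 : a.exponent S = 2 → (l.map ZigZag.exponent).sum S = 2 * l.length := by
    intro ha
    rw [ZigZag.sum_exponent_apply, List.map_congr_left (g := fun _ => 2), List.map_const',
      List.sum_replicate, smul_eq_mul, mul_comm]
    intro z hz
    rw [ZigZag.exponent_eq_two_iff] at ha ⊢
    exact S.mem_of_le (ZigZag.le_iff.1 ((List.pairwise_cons.1 h).1 z hz)).1 ha
  simp only [List.map_cons, List.sum_cons, Finsupp.add_apply, List.length_cons]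
  constructor
  · omega
  · intro ha
    have := h3 ha
    omega

/-- Dually, the first pair has the largest top element; if `S` misses it, `S` misses every element
of every pair. -/
theorem ZigZag.sum_exponent_eq_zero_iff {a : ZigZag 2 P} {l : List (ZigZag 2 P)}
    (h : (a :: l).Pairwise (· ≤ ·)) (S : PrimeSet P) :
    ((a :: l).map ZigZag.exponent).sum S = 0 ↔ a.toFun 1 ∉ S.1 := by
  rw [← a.exponent_eq_zero_iff S]
  simp only [List.map_cons, List.sum_cons, Finsupp.add_apply, add_eq_zero]
  refine ⟨And.left, fun ha => ⟨ha, ?_⟩⟩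
  rw [ZigZag.sum_exponent_apply, List.sum_eq_zero_iff]
  intro n hn
  obtain ⟨z, hz, rfl⟩ := List.mem_map.1 hn
  rw [ZigZag.exponent_eq_zero_iff] at ha ⊢
  exact fun hz' =>
    ha (S.mem_of_le (ZigZag.le_iff.1 ((List.pairwise_cons.1 h).1 z hz)).2 hz')

theorem ZigZag.eq_of_sum_exponent_eq {l l' : List (ZigZag 2 P)} (hl : l.Pairwise (· ≤ ·))
    (hl' : l'.Pairwise (· ≤ ·))
    (h : (l.map ZigZag.exponent).sum = (l'.map ZigZag.exponent).sum) : l = l' := by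
  have hlen : l.length = l'.length := by
    have := DFunLike.congr_fun h (PrimeSet.univ P)
    rw [ZigZag.sum_exponent_univ, ZigZag.sum_exponent_univ] at this
    omega
  induction l generalizing l' with
  | nil => exact (List.length_eq_zero_iff.1 hlen.symm).symm
  | cons a l ih =>
    cases l' with
    | nil => simp at hlen
    | cons b l' =>
      have h0 : ∀ S : PrimeSet P, a.toFun 0 ∈ S.1 ↔ b.toFun 0 ∈ S.1 := fun S => by
        rw [← ZigZag.sum_exponent_eq_iff hl, ← ZigZag.sum_exponent_eq_iff hl', h, hlen]
      have h1 : ∀ S : PrimeSet P, a.toFun 1 ∈ S.1 ↔ b.toFun 1 ∈ S.1 := fun S => by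
        rw [← not_iff_not, ← ZigZag.sum_exponent_eq_zero_iff hl,
          ← ZigZag.sum_exponent_eq_zero_iff hl', h]
      obtain rfl : a = b := le_antisymm
        (ZigZag.le_iff.2 ⟨PrimeSet.le_of_forall fun S => (h0 S).1,
          PrimeSet.le_of_forall fun S => (h1 S).2⟩)
        (ZigZag.le_iff.2 ⟨PrimeSet.le_of_forall fun S => (h0 S).2,
          PrimeSet.le_of_forall fun S => (h1 S).1⟩)
      rw [ih (List.pairwise_cons.1 hl).2 (List.pairwise_cons.1 hl').2 (by simpa using h)
        (by simpa using hlen)]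

end PrimeSets

/-! ### Straightening and spanning in the Veronese algebra -/

section HibiRing

variable (K : Type*) [Field K] {P : Type*} [DistribLattice P]

theorem hibiVar_mul_hibiVar (a b : P) :
    hibiVar K a * hibiVar K b = hibiVar K (a ⊓ b) * hibiVar K (a ⊔ b) := by
  by_cases hab : a ≤ b
  · rw [inf_eq_left.2 hab, sup_eq_right.2 hab]
  by_cases hba : b ≤ a
  · rw [inf_eq_right.2 hba, sup_eq_left.2 hba, mul_comm]
  simp only [hibiVar, ← map_mul]
  exact Ideal.Quotient.eq.2 (Ideal.subset_span ⟨a, b, hab, hba, rfl⟩)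

theorem coe_zigZagMonomial_two (z : ZigZag 2 P) :
    (zigZagMonomial K 2 z : HibiRing K P) = hibiVar K (z.toFun 0) * hibiVar K (z.toFun 1) := by
  simp [zigZagMonomial, Fin.prod_univ_two]

theorem zigZagMonomial_mul (z w : ZigZag 2 P) :
    zigZagMonomial K 2 z * zigZagMonomial K 2 w =
      zigZagMonomial K 2 (z.lower w) * zigZagMonomial K 2 (z.upper w) := by
  apply Subtype.ext
  simp only [MulMemClass.coe_mul, coe_zigZagMonomial_two, ZigZag.lower, ZigZag.upper,
    ZigZag.pair_zero, ZigZag.pair_one]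
  -- Undo the sorting of the two middle elements; relations for the bottoms and for the tops then
  -- suffice.
  rw [← hibiVar_mul_hibiVar K (z.toFun 0 ⊔ w.toFun 0)]
  have h0 := hibiVar_mul_hibiVar K (z.toFun 0) (w.toFun 0)
  have h1 := hibiVar_mul_hibiVar K (z.toFun 1) (w.toFun 1)
  linear_combination (hibiVar K (z.toFun 1) * hibiVar K (w.toFun 1)) * h0 +
    (hibiVar K (z.toFun 0 ⊓ w.toFun 0) * hibiVar K (z.toFun 0 ⊔ w.toFun 0)) * h1

theorem exists_standardMonomial_eq_prod_hibiVar (n : ℕ) (l : List P) (hl : l.length = 2 * n) :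
    ∃ c : Multichain (ZigZag 2 P),
      (veronese (hibiGrading K P) 2).val (standardMonomial (zigZagMonomial K 2) c) = (l.map (hibiVar K)).prod := by
  have key : ∃ l' : List (ZigZag 2 P),
      (veronese (hibiGrading K P) 2).val (l'.map (zigZagMonomial K 2)).prod = (l.map (hibiVar K)).prod := by
    induction n generalizing l with
    | zero => exact ⟨[], by simp [List.length_eq_zero_iff.1 hl]⟩
    | succ n ih =>
      match l, hl with
      | a :: b :: l, hl =>
        obtain ⟨l', hl'⟩ := ih l (by simp only [List.length_cons] at hl; omega)
        -- Consecutive variables are grouped in twos, each made into a chain by one Hibi relation.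
        refine ⟨ZigZag.pair (a ⊓ b) (a ⊔ b) inf_le_sup :: l', ?_⟩
        rw [List.map_cons, List.prod_cons, map_mul, hl', Subalgebra.coe_val, coe_zigZagMonomial_two,
          ZigZag.pair_zero, ZigZag.pair_one, ← hibiVar_mul_hibiVar]
        simp [mul_assoc]
  obtain ⟨l', hl'⟩ := key
  obtain ⟨c, hc⟩ := exists_standardMonomial_eq_prod (zigZagMonomial K 2) (zigZagMonomial_mul K)
    ZigZag.le_lower ZigZag.lower_le_upper ZigZag.lower_le_right l'
  exact ⟨c, by rw [hc, hl']⟩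

open Classical in
theorem prod_map_hibiVar (s : Multiset P) :
    (s.map (hibiVar K)).prod =
      Ideal.Quotient.mkₐ K (hibiIdeal K P) (MvPolynomial.monomial (Multiset.toFinsupp s) 1) := by
  induction s using Multiset.induction with
  | empty => simp
  | cons a s ih =>
    rw [Multiset.map_cons, Multiset.prod_cons, ih, ← Multiset.singleton_add, map_add,
      Multiset.toFinsupp_singleton, hibiVar, ← map_mul, MvPolynomial.X, MvPolynomial.monomial_mul,
      one_mul]

theorem hibiGrading_eq_span (n : ℕ) :
    hibiGrading K P n =
      Submodule.span K {x | ∃ l : List P, l.length = n ∧ (l.map (hibiVar K)).prod = x} := by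
  classical
  apply le_antisymm
  · rintro _ ⟨f, hf, rfl⟩
    rw [SetLike.mem_coe, MvPolynomial.mem_homogeneousSubmodule] at hf
    rw [f.as_sum, map_sum]
    refine Submodule.sum_mem _ fun d hd => ?_
    have hdeg := hf (MvPolynomial.mem_support_iff.1 hd)
    rw [← mul_one (MvPolynomial.coeff d f), ← smul_eq_mul, ← MvPolynomial.smul_monomial, map_smul]
    refine Submodule.smul_mem _ _ (Submodule.subset_span ⟨d.toMultiset.toList, ?_, ?_⟩)
    · rw [Multiset.length_toList, Finsupp.card_toMultiset, ← hdeg, Finsupp.weight_apply]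
      simp only [Pi.one_apply, smul_eq_mul, mul_one]
      rfl
    · rw [← Multiset.prod_coe, ← Multiset.map_coe, Multiset.coe_toList,
        prod_map_hibiVar, Finsupp.toMultiset_toFinsupp]
      rfl
  · rw [Submodule.span_le]
    rintro _ ⟨l, rfl, rfl⟩
    have h := SetLike.list_prod_map_mem_graded (A := hibiGrading K P) l (fun _ => 1) (hibiVar K)
      fun a _ => ⟨_, MvPolynomial.isHomogeneous_X K a, rfl⟩
    simpa using h

theorem hibiGrading_zero :
    hibiGrading K P 0 = LinearMap.range (Algebra.linearMap K (HibiRing K P)) := by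
  rw [hibiGrading_eq_span, ← Submodule.one_eq_range, Submodule.one_eq_span]
  congr 1
  ext x
  simp [List.length_eq_zero_iff, eq_comm]

theorem span_standardMonomial_eq_top :
    Submodule.span K (Set.range (standardMonomial (zigZagMonomial K (P := P) 2))) = ⊤ := by
  rw [eq_top_iff]
  rintro ⟨x, hx⟩ -
  have hle : (⨆ i, hibiGrading K P (2 * i)) ≤
      (Submodule.span K (Set.range (standardMonomial (zigZagMonomial K (P := P) 2)))).map
        (veronese (hibiGrading K P) 2).val.toLinearMap := by
    refine iSup_le fun i => ?_
    rw [hibiGrading_eq_span, Submodule.span_le]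
    rintro _ ⟨l, hl, rfl⟩
    obtain ⟨c, hc⟩ := exists_standardMonomial_eq_prod_hibiVar K i l hl
    exact ⟨_, Submodule.subset_span ⟨c, rfl⟩, hc⟩
  obtain ⟨y, hy, hyx⟩ := hle hx
  rwa [← show y = ⟨x, hx⟩ from Subtype.ext hyx]

theorem zigZagMonomial_mem (z : ZigZag 2 P) :
    zigZagMonomial K 2 z ∈ veroneseGrading (hibiGrading K P) 2 1 := by
  rw [veroneseGrading, Submodule.mem_comap]
  change (zigZagMonomial K 2 z : HibiRing K P) ∈ _
  rw [coe_zigZagMonomial_two]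
  have hvar : ∀ a : P, hibiVar K a ∈ hibiGrading K P 1 := fun a =>
    ⟨_, MvPolynomial.isHomogeneous_X K a, rfl⟩
  exact SetLike.mul_mem_graded (hvar _) (hvar _)

instance veroneseGrading.instGradedMonoid {A : Type*} [CommRing A] [Algebra K A]
    (𝒜 : ℕ → Submodule K A) [SetLike.GradedMonoid 𝒜] (d : ℕ) :
    SetLike.GradedMonoid (veroneseGrading 𝒜 d) where
  one_mem := by
    change (1 : A) ∈ 𝒜 (d * 0)
    exact SetLike.GradedOne.one_mem (A := 𝒜)
  mul_mem i j a b ha hb := by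
    change (a * b : A) ∈ 𝒜 (d * (i + j))
    rw [mul_add]
    exact SetLike.mul_mem_graded ha hb

theorem iSup_veroneseGrading : ⨆ i, veroneseGrading (hibiGrading K P) 2 i = ⊤ := by
  rw [eq_top_iff, ← span_standardMonomial_eq_top, Submodule.span_le]
  rintro _ ⟨c, rfl⟩
  exact Submodule.mem_iSup_of_mem _ (SetLike.list_prod_map_mem_graded c.1 (fun _ => 1) _
    fun z _ => zigZagMonomial_mem K z)

theorem veroneseGrading_zero : veroneseGrading (hibiGrading K P) 2 0 =
    LinearMap.range (Algebra.linearMap K (veronese (hibiGrading K P) 2)) := by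
  ext x
  rw [veroneseGrading, Submodule.mem_comap, mul_zero, hibiGrading_zero]
  exact exists_congr fun k =>
    (Subtype.ext_iff (a1 := algebraMap K (veronese (hibiGrading K P) 2) k) (a2 := x)).symm

/-! ### Embedding into a polynomial ring -/

variable [Finite P]

/-- The homomorphism from the Hibi ring to a polynomial ring that sends `x_a` to the product of the
variables indexed by the prime sets that contain `a`. -/
noncomputable def hibiToMvPolynomial : HibiRing K P →ₐ[K] MvPolynomial (PrimeSet P) K :=
  Ideal.Quotient.liftₐ (hibiIdeal K P)
    (MvPolynomial.aeval fun a => MvPolynomial.monomial (primeExponent a) 1) (by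
      intro f hf
      rw [← RingHom.mem_ker]
      refine (Ideal.span_le.2 ?_ : hibiIdeal K P ≤ _) hf
      rintro _ ⟨a, b, -, -, rfl⟩
      simp [RingHom.mem_ker, MvPolynomial.monomial_mul, primeExponent_add a b])

theorem hibiToMvPolynomial_hibiVar (a : P) :
    hibiToMvPolynomial K (hibiVar K a) = MvPolynomial.monomial (primeExponent a) 1 :=
  MvPolynomial.aeval_X _ a

/-- The restriction of `hibiToMvPolynomial` to the second Veronese algebra. -/
noncomputable def veroneseToMvPolynomial :
    veronese (hibiGrading K P) 2 →ₐ[K] MvPolynomial (PrimeSet P) K :=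
  (hibiToMvPolynomial K).comp (veronese (hibiGrading K P) 2).val

theorem veroneseToMvPolynomial_zigZagMonomial (z : ZigZag 2 P) :
    veroneseToMvPolynomial K (zigZagMonomial K 2 z) = MvPolynomial.monomial z.exponent 1 := by
  rw [veroneseToMvPolynomial, AlgHom.comp_apply, Subalgebra.coe_val, coe_zigZagMonomial_two,
    map_mul, hibiToMvPolynomial_hibiVar, hibiToMvPolynomial_hibiVar, MvPolynomial.monomial_mul,
    one_mul, ZigZag.exponent]

theorem veroneseToMvPolynomial_standardMonomial (c : Multichain (ZigZag 2 P)) :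
    veroneseToMvPolynomial K (standardMonomial (zigZagMonomial K 2) c) =
      MvPolynomial.monomial (c.1.map ZigZag.exponent).sum 1 := by
  rw [standardMonomial]
  induction c.1 with
  | nil => simp
  | cons a l ih =>
    rw [List.map_cons, List.prod_cons, map_mul, ih, veroneseToMvPolynomial_zigZagMonomial,
      MvPolynomial.monomial_mul, one_mul, List.map_cons, List.sum_cons]

theorem linearIndependent_veroneseToMvPolynomial_comp :
    LinearIndependent K ((veroneseToMvPolynomial K).toLinearMap ∘
      standardMonomial (zigZagMonomial K (P := P) 2)) := by
  have hinj : Function.Injective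
      fun c : Multichain (ZigZag 2 P) => (c.1.map ZigZag.exponent).sum :=
    fun c c' h => Subtype.ext (ZigZag.eq_of_sum_exponent_eq c.2 c'.2 h)
  have h := (MvPolynomial.basisMonomials (PrimeSet P) K).linearIndependent.comp _ hinj
  rw [MvPolynomial.coe_basisMonomials] at h
  rwa [show (veroneseToMvPolynomial K).toLinearMap ∘ standardMonomial (zigZagMonomial K 2) = _
    from funext (veroneseToMvPolynomial_standardMonomial K)]

theorem veroneseToMvPolynomial_injective :
    Function.Injective (veroneseToMvPolynomial K (P := P)) :=
  (veroneseToMvPolynomial K).toLinearMap.injective_of_linearIndependent_comp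
    (span_standardMonomial_eq_top K) (linearIndependent_veroneseToMvPolynomial_comp K)

theorem isDomain_veronese_hibiGrading : IsDomain (veronese (hibiGrading K P) 2) :=
  (veroneseToMvPolynomial_injective K).isDomain (veroneseToMvPolynomial K).toRingHom

-- The weight counts only the variable of the whole lattice, which occurs once in the image of every
-- `x_a`.
open Classical in
theorem hibiToMvPolynomial_mem {n : ℕ} {x : HibiRing K P} (hx : x ∈ hibiGrading K P n) :
    hibiToMvPolynomial K x ∈ MvPolynomial.weightedHomogeneousSubmodule K
      (Pi.single (PrimeSet.univ P) 1 : PrimeSet P → ℕ) n := by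
  rw [hibiGrading_eq_span] at hx
  refine (Submodule.span_le (p := (MvPolynomial.weightedHomogeneousSubmodule K
      (Pi.single (PrimeSet.univ P) 1 : PrimeSet P → ℕ) n).comap
      (hibiToMvPolynomial K).toLinearMap)).2 ?_ hx
  rintro _ ⟨l, rfl, rfl⟩
  change MvPolynomial.IsWeightedHomogeneous _ (hibiToMvPolynomial K _) _
  clear hx
  induction l with
  | nil => simpa using MvPolynomial.isWeightedHomogeneous_one K _
  | cons a l ih =>
    rw [List.map_cons, List.prod_cons, map_mul, hibiToMvPolynomial_hibiVar, List.length_cons,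
      add_comm]
    refine MvPolynomial.IsWeightedHomogeneous.mul
      (MvPolynomial.isWeightedHomogeneous_monomial _ _ _ ?_) ih
    simp [Finsupp.weight_apply, Pi.single_apply, primeExponent_univ]

theorem iSupIndep_veroneseGrading : iSupIndep (veroneseGrading (hibiGrading K P) 2) := by
  classical
  intro i
  let w : PrimeSet P → ℕ := Pi.single (PrimeSet.univ P) 1
  -- `L` kills every component except the `i`-th, on which it agrees with the injective embedding.
  let L := (MvPolynomial.weightedHomogeneousComponent (R := K) w (2 * i)) ∘ₗ
    (veroneseToMvPolynomial K (P := P)).toLinearMap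
  have hL : ∀ k, ∀ x ∈ veroneseGrading (hibiGrading K P) 2 k,
      L x = if 2 * i = 2 * k then veroneseToMvPolynomial K x else 0 := fun k x hx =>
    MvPolynomial.weightedHomogeneousComponent_of_mem (hibiToMvPolynomial_mem K hx)
  rw [Submodule.disjoint_def]
  intro x hx hx'
  have hker : (⨆ k, ⨆ (_ : k ≠ i), veroneseGrading (hibiGrading K P) 2 k) ≤ LinearMap.ker L :=
    iSup₂_le fun k hk y hy => by
      rw [LinearMap.mem_ker, hL k y hy, if_neg (by omega)]
  have h0 := hL i x hx
  rw [LinearMap.mem_ker.1 (hker hx'), if_pos rfl] at h0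
  exact veroneseToMvPolynomial_injective K (by rw [← h0, map_zero])

theorem isASL_veronese_hibiGrading :
    IsASL K (veroneseGrading (hibiGrading K P) 2) (zigZagMonomial K (P := P) 2) where
  injective z w h := by
    have hli := (linearIndependent_veroneseToMvPolynomial_comp K (P := P)).of_comp
    have hzw := hli.injective (a₁ := ⟨[z], List.pairwise_singleton _ _⟩)
      (a₂ := ⟨[w], List.pairwise_singleton _ _⟩) (by simpa [standardMonomial] using h)
    simpa using hzw
  gradedMonoid := inferInstance
  isInternal := DirectSum.isInternal_submodule_of_iSupIndep_of_iSup_eq_top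
    (iSupIndep_veroneseGrading K) (iSup_veroneseGrading K)
  degree_zero := veroneseGrading_zero K
  homogeneous z := ⟨1, one_pos, zigZagMonomial_mem K z⟩
  generate := by
    rw [eq_top_iff, ← Subalgebra.toSubmodule.le_iff_le, Algebra.top_toSubmodule,
      ← span_standardMonomial_eq_top, Submodule.span_le]
    rintro _ ⟨c, rfl⟩
    refine Subalgebra.list_prod_mem _ fun x hx => ?_
    obtain ⟨z, -, rfl⟩ := List.mem_map.1 hx
    exact Algebra.subset_adjoin ⟨z, rfl⟩
  linearIndependent := (linearIndependent_veroneseToMvPolynomial_comp K).of_comp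
  span_eq_top := span_standardMonomial_eq_top K
  straightening z w hzw hwz := by
    refine ⟨Finsupp.single ⟨[z.lower w, z.upper w], by simpa using z.lower_le_upper w⟩ 1, ?_, ?_⟩
    · simp [standardMonomial, zigZagMonomial_mul K z w]
    · intro l hl
      rw [Finset.mem_singleton.1 (Finsupp.support_single_subset hl)]
      -- If the meet equalled `z` or `w`, the two would be comparable.
      refine ⟨z.lower w, rfl, (z.lower_le_left w).lt_of_ne fun h => hzw ?_,
        (z.lower_le_right w).lt_of_ne fun h => hwz ?_⟩
      · exact h ▸ z.lower_le_right w
      · exact h ▸ z.lower_le_left w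

end HibiRing

theorem mainTheorem8 (K : Type*) [Field K] (P : Type*) [DistribLattice P] [Finite P] :
    IsIntegralPoset K (ZigZag 2 P) ∧
      IsASL K (veroneseGrading (hibiGrading K P) 2) (zigZagMonomial K (P := P) 2) ∧
      IsDomain (veronese (hibiGrading K P) 2) :=
  ⟨⟨veronese (hibiGrading K P) 2, inferInstance, inferInstance, _, _,
    isASL_veronese_hibiGrading K, isDomain_veronese_hibiGrading K⟩,
    isASL_veronese_hibiGrading K, isDomain_veronese_hibiGrading K⟩
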